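/- Let $N\in\mathbb{N}$, let $h_s$ be a self-adjoint operator on $\mathbb{C}^N$ with standard orthonormal basis $\zeta_1,\dots,\zeta_N$, and let $\nu_{jk}\in\mathbb{R}$ for $1\le j,k\le N$. For $\lambda\ge 0$ and a density matrix $\gamma$ (an operator $\gamma\ge 0$ on $\mathbb{C}^N$) put $$V_\lambda\{\gamma\}:=\lambda\sum_{j=1}^N\Big(\sum_{k=1}^N\nu_{jk}\langle\zeta_k,\gamma\,\zeta_k\rangle\Big)|\zeta_j\rangle\langle\zeta_j| .$$ For $\beta_s>0$ and $\mathcal{N}\in(0,N)$ let $\mu_s(\gamma)$ be the unique real solution $x$ of $$\mathrm{Tr}\Big(\frac{1}{e^{\beta_s(h_s+V_\lambda\{\gamma\}-x)}+1}\Big)=\mathcal{N}.$$ Then for every $\beta_s>0$, $\lambda\ge 0$ and $\mathcal{N}\in(0,N)$ there exists at least one density matrix $\rho_s\geq 0$ such that $$\rho_s=\frac{1}{e^{\beta_s(h_s+V_\lambda\{\rho_s\}-\mu_s(\rho_s))}+1},\qquad \mathrm{Tr}(\rho_s)=\mathcal{N}.$$ Every such $\rho_s$ commutes with $h_s+V_\lambda\{\rho_s\}$.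 Moreover, for all $\beta_s>0$ and $\mathcal{N}\in(0,N)$ there exists $\lambda_*>0$ (which may depend on $h_s$, $\nu$, $\beta_s$ and $\mathcal{N}$) such that if $0\le\lambda\le\lambda_*$ then such a density matrix $\rho_s$ is unique. -/

import Mathlib

open scoped ComplexOrder

namespace Hartree

/-- The Hartree potential
`V_lam{γ} = lam * ∑ j, (∑ k, ν j k * ⟨ζ_k, γ ζ_k⟩) |ζ_j⟩⟨ζ_j|`,
written in the standard basis `ζ` of `ℂ^N`, where `⟨ζ_k, γ ζ_k⟩ = γ k k`. -/
noncomputable def hartreePotential {N : ℕ} (ν : Fin N → Fin N → ℝ) (lam : ℝ)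
    (γ : Matrix (Fin N) (Fin N) ℂ) : Matrix (Fin N) (Fin N) ℂ :=
  (lam : ℂ) • Matrix.diagonal fun j => ∑ k, (ν j k : ℂ) * γ k k

/-- The Fermi-Dirac operator `1 / (exp (β (H - x)) + 1)` (matrix exponential and inverse). -/
noncomputable def fermiDirac {N : ℕ} (β x : ℝ) (H : Matrix (Fin N) (Fin N) ℂ) :
    Matrix (Fin N) (Fin N) ℂ :=
  (NormedSpace.exp ((β : ℂ) • (H - (x : ℂ) • (1 : Matrix (Fin N) (Fin N) ℂ))) + 1)⁻¹

/-- The chemical potential: the solution `x` of `Tr (1 / (exp (β (H - x)) + 1)) = n`. For a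
Hermitian `H`, `0 < β` and `0 < n < N` it exists and is unique: see `existsUnique_trace_eq`,
`trace_chemicalPotential` and `eq_chemicalPotential` below. -/
noncomputable def chemicalPotential {N : ℕ} (β n : ℝ) (H : Matrix (Fin N) (Fin N) ℂ) : ℝ :=
  Classical.epsilon fun x : ℝ => (fermiDirac β x H).trace = (n : ℂ)

/-- The chemical potential `μ_s(γ)` of the sample with the Hamiltonian `h + V_lam{γ}`. -/
noncomputable def sampleChemicalPotential {N : ℕ} (h : Matrix (Fin N) (Fin N) ℂ)
    (ν : Fin N → Fin N → ℝ) (β lam n : ℝ) (γ : Matrix (Fin N) (Fin N) ℂ) : ℝ :=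
  chemicalPotential β n (h + hartreePotential ν lam γ)

/-- `ρ` is a self-consistent density matrix with `n` particles:
`ρ ≥ 0`, `ρ = 1 / (exp (β (h + V_lam{ρ} - μ_s(ρ))) + 1)` and `Tr ρ = n`. -/
structure IsSelfConsistent {N : ℕ} (h : Matrix (Fin N) (Fin N) ℂ)
    (ν : Fin N → Fin N → ℝ) (β lam n : ℝ) (ρ : Matrix (Fin N) (Fin N) ℂ) : Prop where
  posSemidef : ρ.PosSemidef
  eq_fermiDirac : ρ = fermiDirac β (sampleChemicalPotential h ν β lam n ρ)
    (h + hartreePotential ν lam ρ)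
  trace_eq : ρ.trace = (n : ℂ)

/-- The sample Hamiltonian with the Hartree term of a density matrix is self-adjoint. -/
theorem isHermitian_add_hartreePotential {N : ℕ} {h : Matrix (Fin N) (Fin N) ℂ}
    (hh : h.IsHermitian) (ν : Fin N → Fin N → ℝ) (lam : ℝ)
    {γ : Matrix (Fin N) (Fin N) ℂ} (hγ : γ.PosSemidef) :
    (h + hartreePotential ν lam γ).IsHermitian := by
  refine hh.add ?_
  have hd : ∀ k, (starRingEnd ℂ) (γ k k) = γ k k := fun k => hγ.isHermitian.apply k k
  ext i j
  by_cases hij : i = j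
  · subst hij
    simp [hartreePotential, hd]
  · simp [hartreePotential, Matrix.diagonal, hij, Ne.symm hij]

/-- The trace of the Fermi-Dirac operator in terms of eigenvalues. -/
theorem trace_fermiDirac {N : ℕ} {H : Matrix (Fin N) (Fin N) ℂ} (hH : H.IsHermitian)
    (β x : ℝ) : (fermiDirac β x H).trace =
      ((∑ i, (Real.exp (β * (hH.eigenvalues i - x)) + 1)⁻¹ : ℝ) : ℂ) := by
  set U : Matrix (Fin N) (Fin N) ℂ := (hH.eigenvectorUnitary : Matrix (Fin N) (Fin N) ℂ) with hU
  have h1 : U * star U = 1 := Unitary.coe_mul_star_self hH.eigenvectorUnitary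
  have h2 : star U * U = 1 := Unitary.coe_star_mul_self hH.eigenvectorUnitary
  have hinv : U⁻¹ = star U := Matrix.inv_eq_right_inv h1
  have hunit : IsUnit U := IsUnit.of_mul_eq_one _ h1
  have hspec : H = U * Matrix.diagonal (fun i => (hH.eigenvalues i : ℂ)) * star U := by
    have := hH.spectral_theorem
    rw [Unitary.conjStarAlgAut_apply] at this
    exact this
  have hA : (β : ℂ) • (H - (x : ℂ) • (1 : Matrix (Fin N) (Fin N) ℂ)) =
      U * Matrix.diagonal (fun i => (β : ℂ) * ((hH.eigenvalues i : ℂ) - x)) * U⁻¹ := by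
    have hD : Matrix.diagonal (fun i => (β : ℂ) * ((hH.eigenvalues i : ℂ) - x)) =
        (β : ℂ) • (Matrix.diagonal (fun i => (hH.eigenvalues i : ℂ)) -
          (x : ℂ) • (1 : Matrix (Fin N) (Fin N) ℂ)) := by
      ext i j
      by_cases hij : i = j
      · subst hij; simp
      · simp [hij]
    rw [hD, hinv]
    conv_lhs => rw [hspec]
    simp [mul_sub, sub_mul, h1]
  have hne : ∀ i, ((Real.exp (β * (hH.eigenvalues i - x)) + 1 : ℝ) : ℂ) ≠ 0 := fun i =>
    Complex.ofReal_ne_zero.2 (by positivity)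
  have hF : fermiDirac β x H = U * Matrix.diagonal
      (fun i => (((Real.exp (β * (hH.eigenvalues i - x)) + 1)⁻¹ : ℝ) : ℂ)) * star U := by
    have hE : NormedSpace.exp ((β : ℂ) • (H - (x : ℂ) • (1 : Matrix (Fin N) (Fin N) ℂ))) + 1 =
        U * Matrix.diagonal
          (fun i => ((Real.exp (β * (hH.eigenvalues i - x)) + 1 : ℝ) : ℂ)) * star U := by
      have hD : Matrix.diagonal
          (fun i => ((Real.exp (β * (hH.eigenvalues i - x)) + 1 : ℝ) : ℂ)) =
          Matrix.diagonal (NormedSpace.exp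
            (fun i => (β : ℂ) * ((hH.eigenvalues i : ℂ) - x))) + 1 := by
        ext i j
        by_cases hij : i = j
        · subst hij; simp [Pi.coe_exp, ← Complex.exp_eq_exp_ℂ]
        · simp [hij]
      rw [hA, Matrix.exp_conj _ _ hunit, Matrix.exp_diagonal, hD, hinv]
      simp [mul_add, add_mul, h1]
    rw [fermiDirac, hE]
    refine Matrix.inv_eq_right_inv ?_
    have : ∀ A B : Matrix (Fin N) (Fin N) ℂ,
        U * A * star U * (U * B * star U) = U * (A * B) * star U := fun A B => by
      calc U * A * star U * (U * B * star U) = U * A * (star U * U) * B * star U := by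
            simp only [mul_assoc]
        _ = U * (A * B) * star U := by rw [h2]; simp only [mul_assoc, mul_one]
    rw [this, Matrix.diagonal_mul_diagonal]
    have hone : (fun i => ((Real.exp (β * (hH.eigenvalues i - x)) + 1 : ℝ) : ℂ) *
        (((Real.exp (β * (hH.eigenvalues i - x)) + 1)⁻¹ : ℝ) : ℂ)) = fun _ => 1 := by
      funext i
      rw [Complex.ofReal_inv, mul_inv_cancel₀ (hne i)]
    rw [hone, Matrix.diagonal_one, mul_one, h1]
  rw [hF, Matrix.trace_mul_comm, ← mul_assoc, h2, one_mul, Matrix.trace_diagonal]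
  push_cast
  rfl

/-- The equation of the chemical potential has exactly one solution. -/
theorem existsUnique_trace_eq {N : ℕ} {H : Matrix (Fin N) (Fin N) ℂ} (hH : H.IsHermitian)
    {β n : ℝ} (hβ : 0 < β) (hn : 0 < n) (hnN : n < N) :
    ∃! x : ℝ, (fermiDirac β x H).trace = (n : ℂ) := by
  have hN : 0 < N := by
    have : (0 : ℝ) < N := hn.trans hnN
    exact_mod_cast this
  have : Nonempty (Fin N) := ⟨⟨0, hN⟩⟩
  simp only [trace_fermiDirac hH, Complex.ofReal_inj]
  set f : ℝ → ℝ := fun x => ∑ i, (Real.exp (β * (hH.eigenvalues i - x)) + 1)⁻¹ with hf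
  have hmono : StrictMono f := fun x y hxy => by
    refine Finset.sum_lt_sum_of_nonempty Finset.univ_nonempty fun i _ => ?_
    have : Real.exp (β * (hH.eigenvalues i - y)) < Real.exp (β * (hH.eigenvalues i - x)) :=
      Real.exp_lt_exp.2 (mul_lt_mul_of_pos_left (by linarith) hβ)
    exact inv_strictAnti₀ (by positivity) (by linarith)
  have hcont : Continuous f := by
    refine continuous_finsetSum _ fun i _ => ?_
    exact Continuous.inv₀ (by fun_prop) fun x => by positivity
  have hbot : Filter.Tendsto f Filter.atBot (nhds 0) := by
    have : Filter.Tendsto f Filter.atBot (nhds (∑ _i : Fin N, (0 : ℝ))) := by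
      refine tendsto_finsetSum _ fun i _ => ?_
      refine Filter.Tendsto.inv_tendsto_atTop ?_
      refine Filter.tendsto_atTop_add_const_right _ _ (Real.tendsto_exp_atTop.comp ?_)
      refine Filter.Tendsto.const_mul_atTop hβ ?_
      exact (Filter.tendsto_atTop_add_const_left _ (hH.eigenvalues i)
        Filter.tendsto_neg_atBot_atTop).congr fun x => (sub_eq_add_neg _ x).symm
    simpa using this
  have htop : Filter.Tendsto f Filter.atTop (nhds N) := by
    have : Filter.Tendsto f Filter.atTop (nhds (∑ _i : Fin N, ((0 : ℝ) + 1)⁻¹)) := by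
      refine tendsto_finsetSum _ fun i _ => ?_
      refine Filter.Tendsto.inv₀ ?_ (by norm_num)
      refine Filter.Tendsto.add_const _ (Real.tendsto_exp_atBot.comp ?_)
      refine Filter.Tendsto.const_mul_atBot hβ ?_
      exact (Filter.tendsto_atBot_add_const_left _ (hH.eigenvalues i)
        Filter.tendsto_neg_atTop_atBot).congr fun x => (sub_eq_add_neg _ x).symm
    simpa using this
  obtain ⟨a, ha⟩ := (hbot.eventually_lt_const hn).exists
  obtain ⟨b, hb⟩ := (htop.eventually_const_lt hnN).exists
  obtain ⟨x, hx⟩ := mem_range_of_exists_le_of_exists_ge hcont ⟨a, ha.le⟩ ⟨b, hb.le⟩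
  exact ⟨x, hx, fun y hy => hmono.injective (hy.trans hx.symm)⟩

/-- The chemical potential solves its equation. -/
theorem trace_chemicalPotential {N : ℕ} {H : Matrix (Fin N) (Fin N) ℂ} (hH : H.IsHermitian)
    {β n : ℝ} (hβ : 0 < β) (hn : 0 < n) (hnN : n < N) :
    (fermiDirac β (chemicalPotential β n H) H).trace = (n : ℂ) :=
  Classical.epsilon_spec (p := fun x : ℝ => (fermiDirac β x H).trace = (n : ℂ))
    (existsUnique_trace_eq hH hβ hn hnN).exists

/-- The chemical potential is the only solution of its equation. -/
theorem eq_chemicalPotential {N : ℕ} {H : Matrix (Fin N) (Fin N) ℂ} (hH : H.IsHermitian)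
    {β n x : ℝ} (hβ : 0 < β) (hn : 0 < n) (hnN : n < N)
    (hx : (fermiDirac β x H).trace = (n : ℂ)) : x = chemicalPotential β n H :=
  (existsUnique_trace_eq hH hβ hn hnN).unique hx (trace_chemicalPotential hH hβ hn hnN)

end Hartree

/-! A self-consistent state enters its own Hamiltonian only through its diagonal `d`, so the matrix
equation reduces to a fixed point problem in `ℝ^N`: `d` must equal `equilibriumDensity` of the
potential `lam • meanField ν d`. This map is bounded, since a density has nonnegative entries
summing to `n`, and it is `C¹`: matrix exponential and inverse are smooth, and the implicit function
theorem handles the chemical potential. Brouwer's theorem gives existence. For small `lam` all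
relevant potentials lie near `0`, where `equilibriumDensity` is Lipschitz, so the map contracts and
the fixed point is unique. Commutation holds because the state is a function of its Hamiltonian.

Brouwer's theorem is obtained from the absence of a `C¹` retraction onto the sphere, by the volume
argument of Milnor and Rogers. -/

/-! ### Brouwer's fixed point theorem -/

/-- Lagrange interpolation. The weights do not depend on `q`, so they can later be pulled out of an
integral over a family of polynomials. -/
theorem exists_weights_eval_one (d : ℕ) {a : ℝ} (ha : 0 < a) :
    ∃ t w : Fin (d + 1) → ℝ, (∀ i, 0 < t i ∧ t i < a) ∧
      ∀ q : Polynomial ℝ, q.natDegree ≤ d → q.eval 1 = ∑ i, w i * q.eval (t i) := by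
  obtain ⟨t, ht⟩ : ∃ t : Fin (d + 1) → ℝ, (∀ i, 0 < t i ∧ t i < a) ∧ Function.Injective t := by
    refine ⟨fun i => a / (i + 2), fun i => ⟨by positivity, ?_⟩, fun i j hij => ?_⟩
    · exact div_lt_self ha (by have : (0 : ℝ) ≤ (i : ℕ) := by positivity
                               linarith)
    · have h2 : ((i : ℕ) : ℝ) + 2 = (j : ℕ) + 2 := by
        have hi : ((i : ℕ) : ℝ) + 2 ≠ 0 := by positivity
        have hj : ((j : ℕ) : ℝ) + 2 ≠ 0 := by positivity
        field_simp at hij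
        linarith
      exact Fin.ext (by exact_mod_cast add_right_cancel h2)
  refine ⟨t, fun i => (Lagrange.basis Finset.univ t i).eval 1, ht.1, fun q hq => ?_⟩
  have hdeg : q.degree < (Finset.univ : Finset (Fin (d + 1))).card := by
    rw [Finset.card_univ, Fintype.card_fin]
    exact (Polynomial.degree_le_of_natDegree_le hq).trans_lt (by exact_mod_cast Nat.lt_succ_self d)
  conv_lhs => rw [Lagrange.eq_interpolate (s := Finset.univ) (v := t) ht.2.injOn hdeg]
  rw [Lagrange.interpolate_apply, Polynomial.eval_finsetSum]
  exact Finset.sum_congr rfl fun i _ => by simp [mul_comm]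

theorem LinearMap.exists_polynomial_det_id_add_smul {E : Type*} [AddCommGroup E] [Module ℝ E]
    [FiniteDimensional ℝ E] (A : E →ₗ[ℝ] E) :
    ∃ q : Polynomial ℝ, q.natDegree ≤ Module.finrank ℝ E ∧
      ∀ t : ℝ, LinearMap.det (LinearMap.id + t • A) = q.eval t := by
  classical
  let b := Module.finBasis ℝ E
  let M := LinearMap.toMatrix b b A
  refine ⟨((Polynomial.X : Polynomial ℝ) • M.map Polynomial.C +
    (1 : Matrix _ _ ℝ).map Polynomial.C).det, ?_, fun t => ?_⟩
  · simpa using Polynomial.natDegree_det_X_add_C_le M 1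
  · rw [← LinearMap.det_toMatrix b, ← Polynomial.coe_evalRingHom, RingHom.map_det]
    congr 1
    ext i j
    simp [M, Matrix.one_apply, add_comm]
    split_ifs <;> simp <;> ring

open MeasureTheory Metric in
/-- There is no continuously differentiable retraction of the closed unit ball onto its sphere. -/
theorem not_exists_contDiff_retraction {E : Type*} [NormedAddCommGroup E] [InnerProductSpace ℝ E]
    [FiniteDimensional ℝ E] {f : E → E} (hf : ∀ x, ‖x‖ ≤ 1 → ContDiffAt ℝ 1 f x)
    (hf1 : ∀ x, ‖x‖ ≤ 1 → ‖f x‖ = 1) (hfid : ∀ x, ‖x‖ = 1 → f x = x) : False := by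
  let _ : MeasurableSpace E := borel E
  have : BorelSpace E := ⟨rfl⟩
  set g : E → E := fun x => f x - x with hg
  have hgc : ∀ x, ‖x‖ ≤ 1 → ContDiffAt ℝ 1 g x := fun x hx => (hf x hx).sub contDiffAt_id
  have hgd : ∀ x, ‖x‖ ≤ 1 → DifferentiableAt ℝ g x := fun x hx =>
    (hgc x hx).differentiableAt one_ne_zero
  have hcomp : IsCompact (closedBall (0 : E) 1) := isCompact_closedBall 0 1
  have hg'c : ContinuousOn (fderiv ℝ g) (closedBall 0 1) := fun x hx =>
    ((hgc x (by simpa using hx)).continuousAt_fderiv one_ne_zero).continuousWithinAt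
  obtain ⟨K, hK⟩ := hcomp.exists_bound_of_continuousOn hg'c
  have hKpos : 0 ≤ K := (norm_nonneg _).trans (hK 0 (by simp))
  have hlip : ∀ x y, ‖x‖ ≤ 1 → ‖y‖ ≤ 1 → ‖g x - g y‖ ≤ K * ‖x - y‖ := fun x y hx hy =>
    (convex_closedBall (0 : E) 1).norm_image_sub_le_of_norm_fderiv_le (𝕜 := ℝ)
      (fun z hz => hgd z (by simpa using hz)) hK (by simpa using hy) (by simpa using hx)
  obtain ⟨δ, hδ, hdet⟩ : ∃ δ > 0, ∀ A : E →L[ℝ] E, ‖A‖ < δ →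
      0 < (ContinuousLinearMap.id ℝ E + A).det := by
    have hc : ContinuousAt (fun A : E →L[ℝ] E => (ContinuousLinearMap.id ℝ E + A).det) 0 :=
      (ContinuousLinearMap.continuous_det.comp (continuous_const.add continuous_id)).continuousAt
    have : ∀ᶠ A in nhds (0 : E →L[ℝ] E), 0 < (ContinuousLinearMap.id ℝ E + A).det :=
      hc.eventually_const_lt (by simp [ContinuousLinearMap.det])
    obtain ⟨δ, hδ, h⟩ := Metric.eventually_nhds_iff.1 this
    exact ⟨δ, hδ, fun A hA => h (by simpa using hA)⟩
  -- For `0 < t < a` the map `x + t • g x` is injective (`t * K < 1`), is a convex combination of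
  -- `x` and `f x` (`t < 1`), and has positive Jacobian (`t * K < δ`).
  set a : ℝ := min δ 1 / (K + 1) with ha
  have hapos : 0 < a := by positivity
  have haδ : a * (K + 1) = min δ 1 := by rw [ha]; field_simp
  set D : ℝ → E → (E →L[ℝ] E) := fun t x => ContinuousLinearMap.id ℝ E + t • fderiv ℝ g x with hD
  have hΦ : ∀ t x, ‖x‖ ≤ 1 → HasStrictFDerivAt (fun x => x + t • g x) (D t x) x := fun t x hx =>
    (hasStrictFDerivAt_id x).add (((hgc x hx).hasStrictFDerivAt one_ne_zero).const_smul t)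
  have hvol : ∀ t, 0 < t → t < a → ∫ x in ball (0 : E) 1, (D t x).det =
      volume.real (ball (0 : E) 1) := by
    intro t ht hta
    have htK1 : t * (K + 1) < min δ 1 := haδ ▸ mul_lt_mul_of_pos_right hta (by positivity)
    have htK : t * K < 1 := by nlinarith [min_le_right δ 1]
    have ht1 : t < 1 := by nlinarith [min_le_right δ 1]
    have hpos : ∀ x, ‖x‖ ≤ 1 → 0 < (D t x).det := fun x hx => by
      refine hdet _ ?_
      rw [norm_smul, Real.norm_of_nonneg ht.le]
      have := hK x (by simpa using hx)
      nlinarith [min_le_left δ 1]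
    set Φ : E → E := fun x => x + t • g x with hΦdef
    have hΦeq : ∀ x, Φ x = (1 - t) • x + t • f x := fun x => by
      simp only [hΦdef, hg]; module
    have hmaps : ∀ x, ‖x‖ < 1 → ‖Φ x‖ < 1 := fun x hx => by
      rw [hΦeq]
      refine (norm_add_le _ _).trans_lt ?_
      rw [norm_smul, norm_smul, Real.norm_of_nonneg ht.le, Real.norm_of_nonneg (by linarith),
        hf1 x hx.le]
      nlinarith
    have hinj : Set.InjOn Φ (ball 0 1) := by
      intro x hx y hy hxy
      simp only [mem_ball_zero_iff] at hx hy
      have h1 : x - y = -(t • (g x - g y)) := by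
        simp only [hΦdef] at hxy
        rw [smul_sub, neg_sub, sub_eq_sub_iff_add_eq_add, hxy, add_comm]
      have h2 : ‖x - y‖ ≤ t * K * ‖x - y‖ := by
        conv_lhs => rw [h1, norm_neg, norm_smul, Real.norm_of_nonneg ht.le]
        rw [mul_assoc]
        exact mul_le_mul_of_nonneg_left (hlip x y hx.le hy.le) ht.le
      have h3 : ‖x - y‖ = 0 := by nlinarith [norm_nonneg (x - y)]
      exact sub_eq_zero.1 (norm_eq_zero.1 h3)
    have hopen : IsOpen (Φ '' ball 0 1) := by
      rw [isOpen_iff_mem_nhds]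
      rintro _ ⟨x, hx, rfl⟩
      have hx' : ‖x‖ ≤ 1 := by simpa using (mem_ball_zero_iff.1 hx).le
      have hsurj : (D t x).range = ⊤ := by
        have := LinearMap.range_eq_top.2 ((LinearMap.equivOfDetNeZero
          (D t x : E →ₗ[ℝ] E) (hpos x hx').ne').surjective)
        exact this
      rw [← (hΦ t x hx').map_nhds_eq_of_surj hsurj]
      exact Filter.image_mem_map (isOpen_ball.mem_nhds hx)
    have hΦcont : ContinuousOn Φ (closedBall 0 1) := fun x hx =>
      (hΦ t x (by simpa using hx)).hasFDerivAt.continuousAt.continuousWithinAt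
    have himage : Φ '' ball 0 1 = ball 0 1 := by
      refine Set.Subset.antisymm ?_ ?_
      · rintro _ ⟨x, hx, rfl⟩
        exact mem_ball_zero_iff.2 (hmaps x (mem_ball_zero_iff.1 hx))
      -- Connectedness: sphere points are fixed by `Φ`, so inside the open ball the images of the
      -- open and the closed ball agree, and that set is both open and relatively closed.
      · refine (convex_ball (0 : E) 1).isPreconnected.subset_left_of_subset_union hopen
          (hcomp.image_of_continuousOn hΦcont).isClosed.isOpen_compl ?_ ?_ ?_
        · exact Set.disjoint_compl_right_iff_subset.2 (Set.image_mono ball_subset_closedBall)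
        · intro y hy
          by_cases h : y ∈ Φ '' closedBall 0 1
          · obtain ⟨x, hx, rfl⟩ := h
            left
            rcases (mem_closedBall_zero_iff.1 hx).lt_or_eq with h | h
            · exact ⟨x, mem_ball_zero_iff.2 h, rfl⟩
            · exfalso
              have : Φ x = x := by rw [hΦeq, hfid x h]; module
              rw [this, mem_ball_zero_iff] at hy
              exact hy.ne h
          · exact Or.inr h
        · exact ⟨Φ 0, mem_ball_zero_iff.2 (hmaps 0 (by simp)), 0, by simp, rfl⟩
    have := integral_image_eq_integral_abs_det_fderiv_smul (volume : Measure E)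
      (s := ball 0 1) measurableSet_ball (f := Φ) (f' := D t)
      (fun x hx => (hΦ t x (mem_ball_zero_iff.1 hx).le).hasFDerivAt.hasFDerivWithinAt) hinj
      (fun _ => (1 : ℝ))
    rw [himage] at this
    simp only [smul_eq_mul, mul_one, setIntegral_const] at this
    rw [this]
    refine setIntegral_congr_fun measurableSet_ball fun x hx => ?_
    exact (abs_of_pos (hpos x (mem_ball_zero_iff.1 hx).le)).symm
  have hint : ∀ t, IntegrableOn (fun x => (D t x).det) (ball (0 : E) 1) := fun t => by
    refine (ContinuousOn.integrableOn_compact hcomp ?_).mono_set ball_subset_closedBall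
    exact ContinuousLinearMap.continuous_det.comp_continuousOn
      (continuousOn_const.add (hg'c.const_smul t))
  obtain ⟨t, w, ht, hw⟩ := exists_weights_eval_one (Module.finrank ℝ E) hapos
  -- The Jacobian is polynomial in `t` of degree at most the dimension, so the volume identity for
  -- small `t` extends to `t = 1`; the weights sum to `1`.
  have hsum : ∀ x, (D 1 x).det = ∑ i, w i * (D (t i) x).det := fun x => by
    obtain ⟨q, hq, hqe⟩ := LinearMap.exists_polynomial_det_id_add_smul
      (fderiv ℝ g x : E →ₗ[ℝ] E)
    have : ∀ s, (D s x).det = q.eval s := fun s => hqe s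
    simp only [this]
    exact hw q hq
  have h1 : ∫ x in ball (0 : E) 1, (D 1 x).det = volume.real (ball (0 : E) 1) := by
    simp only [hsum]
    rw [integral_finsetSum _ fun i _ => (hint (t i)).const_mul (w i)]
    simp only [integral_const_mul]
    rw [Finset.sum_congr rfl fun i _ => by rw [hvol (t i) (ht i).1 (ht i).2], ← Finset.sum_mul]
    have := hw 1 (by simp)
    simp only [Polynomial.eval_one, mul_one] at this
    rw [← this, one_mul]
  -- At `t = 1` the map is `f`. As `‖f‖` is constant, the range of its derivative is orthogonal to
  -- `f x ≠ 0`, so the derivative is singular.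
  have h0 : ∫ x in ball (0 : E) 1, (D 1 x).det = 0 := by
    refine setIntegral_eq_zero_of_forall_eq_zero fun x hx => ?_
    rw [mem_ball_zero_iff] at hx
    have hfx : HasFDerivAt f (D 1 x) x := by
      have := (hΦ 1 x hx.le).hasFDerivAt
      simpa [hg] using this
    by_contra hne
    obtain ⟨v, hv⟩ := (LinearMap.equivOfDetNeZero (D 1 x : E →ₗ[ℝ] E) hne).surjective (f x)
    have hv' : D 1 x v = f x := hv
    have hsq := hfx.norm_sq
    have hconst : (fun y => ‖f y‖ ^ 2) =ᶠ[nhds x] fun _ => (1 : ℝ) := by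
      filter_upwards [isOpen_ball.mem_nhds (mem_ball_zero_iff.2 hx)] with y hy
      rw [hf1 y (mem_ball_zero_iff.1 hy).le, one_pow]
    have hz := hsq.unique ((hasFDerivAt_const (1 : ℝ) x).congr_of_eventuallyEq hconst)
    have := congrArg (fun L => L v) hz
    simp [hv', hf1 x hx.le] at this
  have : 0 < volume.real (ball (0 : E) 1) :=
    ENNReal.toReal_pos (measure_ball_pos _ _ one_pos).ne' measure_ball_lt_top.ne
  linarith

-- Without a fixed point, pushing `x` along the ray from `G x` through `x` until it meets the sphere
-- would be a `C¹` retraction.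
open scoped RealInnerProductSpace in
theorem exists_fixedPoint_of_contDiff {E : Type*} [NormedAddCommGroup E] [InnerProductSpace ℝ E]
    [FiniteDimensional ℝ E] {G : E → E} (hG : ContDiff ℝ 1 G) (hG1 : ∀ x, ‖x‖ ≤ 1 → ‖G x‖ ≤ 1) :
    ∃ x, ‖x‖ ≤ 1 ∧ G x = x := by
  by_contra! hne
  set u : E → E := fun x => x - G x with hu
  have hupos : ∀ x, ‖x‖ ≤ 1 → 0 < ‖u x‖ ^ 2 := fun x hx =>
    pow_pos (norm_pos_iff.2 (sub_ne_zero.2 (hne x hx).symm)) 2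
  have hb : ∀ x, ‖x‖ = 1 → 0 < ⟪x, u x⟫ := fun x hx => by
    have h1 : ‖x - u x‖ ^ 2 ≤ 1 := by
      have : x - u x = G x := by simp [hu]
      rw [this]
      exact pow_le_one₀ (norm_nonneg _) (hG1 x hx.le)
    rw [norm_sub_sq_real, hx] at h1
    have := hupos x hx.le
    linarith
  -- A quarter of the discriminant of `‖x + s • u x‖ ^ 2 = 1` in `s`. Its positivity up to the
  -- sphere makes the larger root `C¹`.
  set Δ : E → ℝ := fun x => ⟪x, u x⟫ ^ 2 + ‖u x‖ ^ 2 * (1 - ‖x‖ ^ 2) with hΔ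
  have hΔpos : ∀ x, ‖x‖ ≤ 1 → 0 < Δ x := fun x hx => by
    rcases hx.lt_or_eq with h | h
    · have : 0 < 1 - ‖x‖ ^ 2 := by nlinarith [norm_nonneg x]
      have := mul_pos (hupos x hx) this
      have := sq_nonneg ⟪x, u x⟫
      simp only [hΔ]
      linarith
    · simp only [hΔ, h]
      have := pow_pos (hb x h) 2
      linarith
  have huc : ContDiff ℝ 1 u := contDiff_id.sub hG
  have hΔc : ContDiff ℝ 1 Δ :=
    ((contDiff_id.inner ℝ huc).pow 2).add
      ((huc.norm_sq ℝ).mul (contDiff_const.sub (contDiff_id.norm_sq ℝ)))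
  refine not_exists_contDiff_retraction
    (f := fun x => x + ((-⟪x, u x⟫ + √(Δ x)) / ‖u x‖ ^ 2) • u x) (fun x hx => ?_) (fun x hx => ?_)
    fun x hx => ?_
  · refine contDiffAt_id.add (ContDiffAt.smul (ContDiffAt.div ?_ (huc.norm_sq ℝ).contDiffAt
      (hupos x hx).ne') huc.contDiffAt)
    exact (contDiff_id.inner ℝ huc).contDiffAt.neg.add (hΔc.contDiffAt.sqrt (hΔpos x hx).ne')
  · have h1 : √(Δ x) ^ 2 = ⟪x, u x⟫ ^ 2 + ‖u x‖ ^ 2 * (1 - ‖x‖ ^ 2) :=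
      Real.sq_sqrt (hΔpos x hx).le
    have ha := (hupos x hx).ne'
    rw [← sq_eq_sq₀ (norm_nonneg _) zero_le_one, norm_add_sq_real, real_inner_smul_right,
      norm_smul, mul_pow, Real.norm_eq_abs, sq_abs]
    set r := √(Δ x)
    set c := ⟪x, u x⟫
    set a := ‖u x‖ ^ 2
    field_simp
    linear_combination h1
  · have h1 : √(Δ x) = ⟪x, u x⟫ := by
      simp only [hΔ, hx]
      rw [one_pow, sub_self, mul_zero, add_zero, Real.sqrt_sq (hb x hx).le]
    simp [h1]

/-- **Brouwer's fixed point theorem**, for a bounded continuous self-map of a Euclidean space. -/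
theorem exists_fixedPoint_of_bounded {E : Type*} [NormedAddCommGroup E] [InnerProductSpace ℝ E]
    [FiniteDimensional ℝ E] {F : E → E} (hF : Continuous F) {R : ℝ} (hR : ∀ x, ‖F x‖ ≤ R) :
    ∃ x, F x = x := by
  by_contra! hne
  have hR0 : 0 ≤ R := (norm_nonneg _).trans (hR 0)
  have hpos : 0 < R + 1 := by linarith
  obtain ⟨x₀, -, hx₀⟩ := (isCompact_closedBall (0 : E) (R + 1)).exists_isMinOn
    (f := fun x => ‖F x - x‖) ⟨0, by simp [hpos.le]⟩ (by fun_prop)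
  have hε : 0 < min ‖F x₀ - x₀‖ 1 := lt_min (norm_pos_iff.2 (sub_ne_zero.2 (hne x₀))) one_pos
  -- The bound `1` keeps `‖G‖ ≤ R + 1`; the bound `‖F x₀ - x₀‖`, the minimal displacement on that
  -- ball, rules out a fixed point of `G` there.
  obtain ⟨G, hG, hGF, -⟩ := hF.exists_contDiff_approx 1 (ε := fun _ => min ‖F x₀ - x₀‖ 1)
    continuous_const (fun _ => hε)
  obtain ⟨y, hy, hfix⟩ := exists_fixedPoint_of_contDiff
    (G := fun y => (R + 1)⁻¹ • G ((R + 1) • y)) (by fun_prop) fun y _ => by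
      have h1 := hGF ((R + 1) • y)
      rw [dist_eq_norm] at h1
      have h2 : ‖G ((R + 1) • y)‖ ≤ R + 1 := by
        have h3 := norm_sub_norm_le (G ((R + 1) • y)) (F ((R + 1) • y))
        linarith [hR ((R + 1) • y), min_le_right ‖F x₀ - x₀‖ 1]
      rw [norm_smul, norm_inv, Real.norm_of_nonneg hpos.le]
      exact inv_mul_le_one_of_le₀ h2 hpos.le
  have hx : G ((R + 1) • y) = (R + 1) • y := by
    conv_rhs => rw [← hfix, smul_inv_smul₀ hpos.ne']
  have hmem : (R + 1) • y ∈ Metric.closedBall (0 : E) (R + 1) := by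
    rw [mem_closedBall_zero_iff, norm_smul, Real.norm_of_nonneg hpos.le]
    nlinarith
  have h1 := hGF ((R + 1) • y)
  rw [hx, dist_comm, dist_eq_norm] at h1
  have h2 := isMinOn_iff.1 hx₀ _ hmem
  linarith [min_le_left ‖F x₀ - x₀‖ 1]

/-! ### Positivity and smoothness of the Fermi-Dirac state -/

namespace Hartree

variable {N : ℕ}

theorem commute_fermiDirac (β x : ℝ) (H : Matrix (Fin N) (Fin N) ℂ) :
    Commute (fermiDirac β x H) H := by
  have h1 : Commute ((β : ℂ) • (H - (x : ℂ) • (1 : Matrix (Fin N) (Fin N) ℂ))) H :=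
    ((Commute.refl H).sub_left ((Commute.one_left H).smul_left _)).smul_left _
  have h2 := h1.exp_left.add_left (Commute.one_left H)
  rw [fermiDirac, Matrix.nonsing_inv_eq_ringInverse]
  by_cases hu : IsUnit (NormedSpace.exp
      ((β : ℂ) • (H - (x : ℂ) • (1 : Matrix (Fin N) (Fin N) ℂ))) + 1)
  · obtain ⟨U, hU⟩ := hu
    rw [← hU] at h2 ⊢
    rw [Ring.inverse_unit]
    exact h2.units_inv_left
  · rw [Ring.inverse_non_unit _ hu]
    exact Commute.zero_left H

/-- The exponential is `Cᴴ * C` with `C = exp (B / 2)`. This supplies both the invertibility and the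
positivity needed for `fermiDirac`. -/
theorem posDef_exp_add_one {B : Matrix (Fin N) (Fin N) ℂ} (hB : B.IsHermitian) :
    (NormedSpace.exp B + 1).PosDef := by
  have h1 : ((2⁻¹ : ℂ) • B).IsHermitian := by
    rw [Matrix.IsHermitian, Matrix.conjTranspose_smul, hB]; simp
  have h2 : NormedSpace.exp B =
      (NormedSpace.exp ((2⁻¹ : ℂ) • B)).conjTranspose * NormedSpace.exp ((2⁻¹ : ℂ) • B) := by
    rw [h1.exp, ← Matrix.exp_add_of_commute _ _ (Commute.refl _), ← add_smul]
    norm_num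
  rw [h2]
  exact Matrix.PosDef.posSemidef_add (Matrix.posSemidef_conjTranspose_mul_self _) Matrix.PosDef.one

theorem isHermitian_smul_sub {H : Matrix (Fin N) (Fin N) ℂ} (hH : H.IsHermitian) (β x : ℝ) :
    ((β : ℂ) • (H - (x : ℂ) • (1 : Matrix (Fin N) (Fin N) ℂ))).IsHermitian := by
  simp [Matrix.IsHermitian, Matrix.conjTranspose_smul, hH.eq]

theorem posSemidef_fermiDirac {H : Matrix (Fin N) (Fin N) ℂ} (hH : H.IsHermitian) (β x : ℝ) :
    (fermiDirac β x H).PosSemidef :=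
  (posDef_exp_add_one (isHermitian_smul_sub hH β x)).inv.posSemidef

theorem isHermitian_add_diagonal {h : Matrix (Fin N) (Fin N) ℂ} (hh : h.IsHermitian)
    (v : Fin N → ℝ) : (h + Matrix.diagonal fun j => (v j : ℂ)).IsHermitian := by
  refine hh.add (Matrix.isHermitian_diagonal_of_self_adjoint _ ?_)
  ext j
  simp

theorem hasDerivAt_trace_fermiDirac_re {H : Matrix (Fin N) (Fin N) ℂ} (hH : H.IsHermitian)
    (β x : ℝ) : HasDerivAt (fun x => (fermiDirac β x H).trace.re)
      (∑ i, β * Real.exp (β * (hH.eigenvalues i - x)) /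
        (Real.exp (β * (hH.eigenvalues i - x)) + 1) ^ 2) x := by
  simp only [trace_fermiDirac hH, Complex.ofReal_re]
  refine HasDerivAt.fun_sum fun i _ => ?_
  have h1 : HasDerivAt (fun x => Real.exp (β * (hH.eigenvalues i - x)) + 1)
      (Real.exp (β * (hH.eigenvalues i - x)) * (β * -1)) x :=
    (((hasDerivAt_id x).const_sub _).const_mul β).exp.add_const 1
  exact (h1.fun_inv (by positivity)).congr_deriv (by ring)

theorem trace_fermiDirac_eq_iff {H : Matrix (Fin N) (Fin N) ℂ} (hH : H.IsHermitian)
    (β x n : ℝ) : (fermiDirac β x H).trace = (n : ℂ) ↔ (fermiDirac β x H).trace.re = n := by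
  rw [trace_fermiDirac hH, Complex.ofReal_inj, Complex.ofReal_re]

section Smoothness

open scoped Matrix.Norms.Operator

theorem contDiff_fermiDirac {h : Matrix (Fin N) (Fin N) ℂ} (hh : h.IsHermitian) (β : ℝ) :
    ContDiff ℝ 1 fun p : EuclideanSpace ℝ (Fin N) × ℝ =>
      fermiDirac β p.2 (h + Matrix.diagonal fun j => (p.1 j : ℂ)) := by
  let L : EuclideanSpace ℝ (Fin N) × ℝ →ₗ[ℝ] Matrix (Fin N) (Fin N) ℂ :=
    { toFun := fun p => Matrix.diagonal (fun j => (p.1 j : ℂ)) - (p.2 : ℂ) • 1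
      map_add' := fun p q => by
        ext i j
        by_cases hij : i = j
        · subst hij; simp; ring
        · simp [hij]
      map_smul' := fun c p => by
        ext i j
        by_cases hij : i = j
        · subst hij; simp; ring
        · simp [hij] }
  have hL : ContDiff ℝ 1 L := (LinearMap.toContinuousLinearMap L).contDiff
  have hin : ContDiff ℝ 1 fun p : EuclideanSpace ℝ (Fin N) × ℝ =>
      (β : ℂ) • (h + Matrix.diagonal (fun j => (p.1 j : ℂ)) -
        (p.2 : ℂ) • (1 : Matrix (Fin N) (Fin N) ℂ)) := by
    have : ContDiff ℝ 1 fun p => (β : ℂ) • (h + L p) := (contDiff_const.add hL).const_smul _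
    simpa only [L, LinearMap.coe_mk, AddHom.coe_mk, add_sub_assoc] using this
  have hexp : ContDiff ℝ 1 (NormedSpace.exp : Matrix (Fin N) (Fin N) ℂ → _) :=
    contDiff_iff_contDiffAt.2 fun x => (NormedSpace.exp_analytic (𝕂 := ℝ) x).contDiffAt
  have hA := (hexp.comp hin).add (contDiff_const (c := (1 : Matrix (Fin N) (Fin N) ℂ)))
  refine contDiff_iff_contDiffAt.2 fun p => ?_
  have hunit := (posDef_exp_add_one
    (isHermitian_smul_sub (isHermitian_add_diagonal hh p.1) β p.2)).isUnit
  simp only [fermiDirac, Matrix.nonsing_inv_eq_ringInverse]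
  exact ContDiffAt.comp (g := Ring.inverse) p
    (by simpa using! contDiffAt_ringInverse ℝ hunit.unit) hA.contDiffAt

/-- Implicit function theorem for the trace equation, whose derivative in `x` is a sum of positive
terms. -/
theorem contDiff_chemicalPotential {h : Matrix (Fin N) (Fin N) ℂ} (hh : h.IsHermitian)
    {β n : ℝ} (hβ : 0 < β) (hn : 0 < n) (hnN : n < N) :
    ContDiff ℝ 1 fun v : EuclideanSpace ℝ (Fin N) =>
      chemicalPotential β n (h + Matrix.diagonal fun j => (v j : ℂ)) := by
  set H : EuclideanSpace ℝ (Fin N) → Matrix (Fin N) (Fin N) ℂ :=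
    fun v => h + Matrix.diagonal fun j => (v j : ℂ)
  have hH : ∀ v, (H v).IsHermitian := fun v => isHermitian_add_diagonal hh v
  let τ : EuclideanSpace ℝ (Fin N) × ℝ → ℝ := fun p => (fermiDirac β p.2 (H p.1)).trace.re
  have hτ : ContDiff ℝ 1 τ := by
    let T : Matrix (Fin N) (Fin N) ℂ →ₗ[ℝ] ℝ :=
      Complex.reLm ∘ₗ Matrix.traceLinearMap (Fin N) ℝ ℂ
    exact (LinearMap.toContinuousLinearMap T).contDiff.comp (contDiff_fermiDirac hh β)
  refine contDiff_iff_contDiffAt.2 fun v₀ => ?_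
  have hμ : ∀ v, τ (v, chemicalPotential β n (H v)) = n := fun v =>
    (trace_fermiDirac_eq_iff (hH v) _ _ _).1 (trace_chemicalPotential (hH v) hβ hn hnN)
  have hat := hτ.contDiffAt (x := (v₀, chemicalPotential β n (H v₀)))
  have hinv : (fderiv ℝ τ (v₀, chemicalPotential β n (H v₀)) ∘L
      .inr ℝ (EuclideanSpace ℝ (Fin N)) ℝ).IsInvertible := by
    set x₀ := chemicalPotential β n (H v₀)
    have h1 := hasDerivAt_trace_fermiDirac_re (hH v₀) β x₀
    have h2 : HasFDerivAt (fun x => τ (v₀, x)) (fderiv ℝ τ (v₀, x₀) ∘L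
        .inr ℝ (EuclideanSpace ℝ (Fin N)) ℝ) x₀ :=
      (hat.differentiableAt one_ne_zero).hasFDerivAt.comp x₀ (hasFDerivAt_prodMk_right v₀ x₀)
    have hne : Nonempty (Fin N) := ⟨⟨0, by
      have : (0 : ℝ) < N := hn.trans hnN
      exact_mod_cast this⟩⟩
    have hpos : 0 < ∑ i, β * Real.exp (β * ((hH v₀).eigenvalues i - x₀)) /
        (Real.exp (β * ((hH v₀).eigenvalues i - x₀)) + 1) ^ 2 :=
      Finset.sum_pos (fun i _ => by positivity) Finset.univ_nonempty
    refine ⟨ContinuousLinearEquiv.unitsEquivAut ℝ (Units.mk0 _ hpos.ne'), ?_⟩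
    rw [h2.unique h1.hasFDerivAt]
    ext
    simp
  -- The local implicit function also solves the trace equation, so by uniqueness it agrees with the
  -- chemical potential near `v₀`.
  have hψ := hat.contDiffAt_implicitFunction one_ne_zero hinv
  refine hψ.congr_of_eventuallyEq ?_
  filter_upwards [hat.eventually_apply_implicitFunction one_ne_zero hinv] with v hv
  rw [hμ v₀] at hv
  exact (eq_chemicalPotential (hH v) hβ hn hnN ((trace_fermiDirac_eq_iff (hH v) _ _ _).2 hv)).symm

end Smoothness

/-! ### The density map and its fixed points -/

/-- The diagonal of the Fermi-Dirac state with `n` particles and the Hamiltonian `h + v`,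
for a diagonal potential `v`. -/
noncomputable def equilibriumDensity (h : Matrix (Fin N) (Fin N) ℂ) (β n : ℝ)
    (v : EuclideanSpace ℝ (Fin N)) : EuclideanSpace ℝ (Fin N) :=
  WithLp.toLp 2 fun k =>
    (fermiDirac β (chemicalPotential β n (h + Matrix.diagonal fun j => (v j : ℂ)))
      (h + Matrix.diagonal fun j => (v j : ℂ)) k k).re

open scoped Matrix.Norms.Operator in
theorem contDiff_equilibriumDensity {h : Matrix (Fin N) (Fin N) ℂ} (hh : h.IsHermitian)
    {β n : ℝ} (hβ : 0 < β) (hn : 0 < n) (hnN : n < N) :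
    ContDiff ℝ 1 (equilibriumDensity h β n) := by
  refine contDiff_euclidean.2 fun k => ?_
  let T : Matrix (Fin N) (Fin N) ℂ →ₗ[ℝ] ℝ :=
    Complex.reLm ∘ₗ Matrix.entryLinearMap ℝ ℂ k k
  have hρ : ContDiff ℝ 1 fun v : EuclideanSpace ℝ (Fin N) =>
      fermiDirac β (chemicalPotential β n (h + Matrix.diagonal fun j => (v j : ℂ)))
        (h + Matrix.diagonal fun j => (v j : ℂ)) :=
    ContDiff.comp
      (g := fun p : EuclideanSpace ℝ (Fin N) × ℝ =>
        fermiDirac β p.2 (h + Matrix.diagonal fun j => (p.1 j : ℂ)))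
      (f := fun v => (v, chemicalPotential β n (h + Matrix.diagonal fun j => (v j : ℂ))))
      (contDiff_fermiDirac hh β)
      (contDiff_id.prodMk (contDiff_chemicalPotential hh hβ hn hnN))
  exact (LinearMap.toContinuousLinearMap T).contDiff.comp hρ

/-- The diagonal entries are nonnegative and sum to `n`. The bound is uniform in `v`, as both
Brouwer and the contraction argument require. -/
theorem equilibriumDensity_mem_Icc {h : Matrix (Fin N) (Fin N) ℂ} (hh : h.IsHermitian)
    {β n : ℝ} (hβ : 0 < β) (hn : 0 < n) (hnN : n < N) (v : EuclideanSpace ℝ (Fin N)) (k : Fin N) :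
    equilibriumDensity h β n v k ∈ Set.Icc 0 n := by
  have hH := isHermitian_add_diagonal hh v
  set H := h + Matrix.diagonal fun j => (v j : ℂ)
  have hpos : ∀ k, 0 ≤ (fermiDirac β (chemicalPotential β n H) H k k).re := fun k =>
    (Complex.le_def.1 ((posSemidef_fermiDirac hH β _).diag_nonneg (i := k))).1
  refine ⟨hpos k, ?_⟩
  have htr := (trace_fermiDirac_eq_iff hH _ _ _).1 (trace_chemicalPotential hH hβ hn hnN)
  rw [Matrix.trace, Complex.re_sum] at htr
  refine le_of_le_of_eq ?_ htr
  exact Finset.single_le_sum (f := fun k => (fermiDirac β (chemicalPotential β n H) H k k).re)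
    (fun i _ => hpos i) (Finset.mem_univ k)

/-- The potential generated by the density `d`, as a linear map. -/
noncomputable def meanField (ν : Fin N → Fin N → ℝ) :
    EuclideanSpace ℝ (Fin N) →L[ℝ] EuclideanSpace ℝ (Fin N) :=
  Matrix.toEuclideanCLM (𝕜 := ℝ) (Matrix.of ν)

theorem meanField_apply (ν : Fin N → Fin N → ℝ) (d : EuclideanSpace ℝ (Fin N)) (j : Fin N) :
    meanField ν d j = ∑ k, ν j k * d k := by
  simp [meanField, Matrix.mulVec, dotProduct]

theorem hartreePotential_eq_diagonal (ν : Fin N → Fin N → ℝ) (lam : ℝ)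
    {ρ : Matrix (Fin N) (Fin N) ℂ} (hρ : ρ.IsHermitian) :
    hartreePotential ν lam ρ = Matrix.diagonal fun j =>
      ((lam • meanField ν (WithLp.toLp 2 fun k => (ρ k k).re)) j : ℂ) := by
  have hre : ∀ k, ((ρ k k).re : ℂ) = ρ k k := fun k => hρ.coe_re_apply_self k
  ext i j
  by_cases hij : i = j
  · subst hij
    simp [hartreePotential, meanField_apply, hre]
  · simp [hartreePotential, hij]

/-- Self-consistent states correspond to fixed points of the density map. -/
theorem IsSelfConsistent.density_eq {h : Matrix (Fin N) (Fin N) ℂ} {ν : Fin N → Fin N → ℝ}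
    {β lam n : ℝ} {ρ : Matrix (Fin N) (Fin N) ℂ} (hρ : IsSelfConsistent h ν β lam n ρ) :
    equilibriumDensity h β n (lam • meanField ν (WithLp.toLp 2 fun k => (ρ k k).re)) =
      WithLp.toLp 2 fun k => (ρ k k).re := by
  have := hρ.eq_fermiDirac
  rw [sampleChemicalPotential, hartreePotential_eq_diagonal ν lam hρ.posSemidef.isHermitian] at this
  ext k
  exact congrArg (fun M : Matrix (Fin N) (Fin N) ℂ => (M k k).re) this.symm

theorem IsSelfConsistent.eq_of_density_eq {h : Matrix (Fin N) (Fin N) ℂ} {ν : Fin N → Fin N → ℝ}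
    {β lam n : ℝ} {ρ σ : Matrix (Fin N) (Fin N) ℂ} (hρ : IsSelfConsistent h ν β lam n ρ)
    (hσ : IsSelfConsistent h ν β lam n σ)
    (hd : (WithLp.toLp 2 fun k => (ρ k k).re : EuclideanSpace ℝ (Fin N)) =
      WithLp.toLp 2 fun k => (σ k k).re) : ρ = σ := by
  rw [hρ.eq_fermiDirac, hσ.eq_fermiDirac, sampleChemicalPotential, sampleChemicalPotential,
    hartreePotential_eq_diagonal ν lam hρ.posSemidef.isHermitian,
    hartreePotential_eq_diagonal ν lam hσ.posSemidef.isHermitian, hd]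

/-- The Fermi-Dirac state in the potential of `d` has diagonal `d`, hence generates that same
potential. -/
theorem exists_isSelfConsistent_of_density_eq {h : Matrix (Fin N) (Fin N) ℂ} (hh : h.IsHermitian)
    (ν : Fin N → Fin N → ℝ) {β lam n : ℝ} (hβ : 0 < β) (hn : 0 < n) (hnN : n < N)
    {d : EuclideanSpace ℝ (Fin N)}
    (hd : equilibriumDensity h β n (lam • meanField ν d) = d) :
    ∃ ρ, IsSelfConsistent h ν β lam n ρ := by
  set H := h + Matrix.diagonal fun j => ((lam • meanField ν d) j : ℂ) with hHdef
  have hH : H.IsHermitian := isHermitian_add_diagonal hh (lam • meanField ν d)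
  have hpsd := posSemidef_fermiDirac hH β (chemicalPotential β n H)
  have hV : h + hartreePotential ν lam (fermiDirac β (chemicalPotential β n H) H) = H := by
    have hd' : WithLp.toLp 2 (fun k => (fermiDirac β (chemicalPotential β n H) H k k).re) = d := hd
    rw [hartreePotential_eq_diagonal ν lam hpsd.isHermitian, hd']
  refine ⟨fermiDirac β (chemicalPotential β n H) H, hpsd, ?_, trace_chemicalPotential hH hβ hn hnN⟩
  rw [sampleChemicalPotential, hV]

/-! ### Existence, and uniqueness at weak coupling -/

theorem exists_isSelfConsistent {h : Matrix (Fin N) (Fin N) ℂ} (hh : h.IsHermitian)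
    (ν : Fin N → Fin N → ℝ) {β n : ℝ} (lam : ℝ) (hβ : 0 < β) (hn : 0 < n) (hnN : n < N) :
    ∃ ρ, IsSelfConsistent h ν β lam n ρ := by
  have hc := (contDiff_equilibriumDensity hh hβ hn hnN).continuous
  obtain ⟨d, hd⟩ := exists_fixedPoint_of_bounded
    (F := fun d => equilibriumDensity h β n (lam • meanField ν d)) (by fun_prop)
    (R := √(∑ _k : Fin N, n ^ 2)) fun d => by
      rw [EuclideanSpace.norm_eq]
      refine Real.sqrt_le_sqrt (Finset.sum_le_sum fun k _ => ?_)
      have := equilibriumDensity_mem_Icc hh hβ hn hnN (lam • meanField ν d) k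
      rw [Real.norm_of_nonneg this.1]
      exact pow_le_pow_left₀ this.1 this.2 2
  exact exists_isSelfConsistent_of_density_eq hh ν hβ hn hnN hd

theorem exists_forall_isSelfConsistent_unique {h : Matrix (Fin N) (Fin N) ℂ} (hh : h.IsHermitian)
    (ν : Fin N → Fin N → ℝ) {β n : ℝ} (hβ : 0 < β) (hn : 0 < n) (hnN : n < N) :
    ∃ lamStar : ℝ, 0 < lamStar ∧ ∀ lam : ℝ, 0 ≤ lam → lam ≤ lamStar → ∀ ρ σ,
      IsSelfConsistent h ν β lam n ρ → IsSelfConsistent h ν β lam n σ → ρ = σ := by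
  obtain ⟨K, s, hs, hK⟩ :=
    (contDiff_equilibriumDensity hh hβ hn hnN).contDiffAt (x := 0).exists_lipschitzOnWith
  obtain ⟨ε, hε, hball⟩ := Metric.mem_nhds_iff.1 hs
  set R : ℝ := √(∑ _k : Fin N, n ^ 2)
  set C : ℝ := ‖meanField ν‖
  have hC : 0 ≤ C := norm_nonneg _
  have hR : 0 ≤ R := Real.sqrt_nonneg _
  -- The first term puts every self-consistent potential in the `ε`-ball where the constant `K` is
  -- valid; the second makes `lam * K * C < 1`. Adding `1` avoids zero denominators, and halving
  -- gives strict inequalities.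
  refine ⟨min (ε / (C * R + 1)) (1 / (K * C + 1)) / 2, by positivity,
    fun lam h0 hlam ρ σ hρ hσ => hρ.eq_of_density_eq hσ ?_⟩
  have hl1 : lam * (C * R + 1) < ε := by
    rw [← lt_div_iff₀ (by positivity)]
    have : 0 < min (ε / (C * R + 1)) (1 / (K * C + 1)) := by positivity
    linarith [min_le_left (ε / (C * R + 1)) (1 / (K * C + 1))]
  have hl2 : lam * (K * C + 1) < 1 := by
    rw [← lt_div_iff₀ (by positivity)]
    have : 0 < min (ε / (C * R + 1)) (1 / (K * C + 1)) := by positivity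
    linarith [min_le_right (ε / (C * R + 1)) (1 / (K * C + 1))]
  have hmem : ∀ ρ, IsSelfConsistent h ν β lam n ρ →
      lam • meanField ν (WithLp.toLp 2 fun k => (ρ k k).re) ∈ s := fun ρ hρ => by
    refine hball ?_
    have hd : ‖(WithLp.toLp 2 fun k => (ρ k k).re : EuclideanSpace ℝ (Fin N))‖ ≤ R := by
      rw [← hρ.density_eq, EuclideanSpace.norm_eq]
      refine Real.sqrt_le_sqrt (Finset.sum_le_sum fun k _ => ?_)
      have := equilibriumDensity_mem_Icc hh hβ hn hnN
        (lam • meanField ν (WithLp.toLp 2 fun k => (ρ k k).re)) k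
      rw [Real.norm_of_nonneg this.1]
      exact pow_le_pow_left₀ this.1 this.2 2
    rw [mem_ball_zero_iff, norm_smul, Real.norm_of_nonneg h0]
    have h1 := ((meanField ν).le_opNorm (WithLp.toLp 2 fun k => (ρ k k).re)).trans
      (mul_le_mul_of_nonneg_left hd hC)
    nlinarith
  have hlip := hK.norm_sub_le (hmem ρ hρ) (hmem σ hσ)
  rw [hρ.density_eq, hσ.density_eq, ← smul_sub, ← map_sub, norm_smul,
    Real.norm_of_nonneg h0] at hlip
  set e : EuclideanSpace ℝ (Fin N) :=
    (WithLp.toLp 2 fun k => (ρ k k).re) - WithLp.toLp 2 fun k => (σ k k).re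
  have h1 : ‖e‖ ≤ lam * (K * C) * ‖e‖ := by
    calc ‖e‖ ≤ K * (lam * ‖meanField ν e‖) := hlip
      _ ≤ K * (lam * (C * ‖e‖)) := by gcongr; exact (meanField ν).le_opNorm e
      _ = lam * (K * C) * ‖e‖ := by ring
  have h2 : ‖e‖ = 0 := by
    have := norm_nonneg e
    by_contra hne
    have : 0 < ‖e‖ := lt_of_le_of_ne this (Ne.symm hne)
    nlinarith
  exact sub_eq_zero.1 (norm_eq_zero.1 h2)

end Hartree

theorem lemma1 (N : ℕ) (h : Matrix (Fin N) (Fin N) ℂ) (hh : h.IsHermitian)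
    (ν : Fin N → Fin N → ℝ) (β : ℝ) (hβ : 0 < β) (n : ℝ) (hn : 0 < n) (hnN : n < N) :
    (∀ lam : ℝ, 0 ≤ lam → ∃ ρ, Hartree.IsSelfConsistent h ν β lam n ρ) ∧
    (∀ lam : ℝ, 0 ≤ lam → ∀ ρ, Hartree.IsSelfConsistent h ν β lam n ρ →
      Commute ρ (h + Hartree.hartreePotential ν lam ρ)) ∧
    (∃ lamStar : ℝ, 0 < lamStar ∧ ∀ lam : ℝ, 0 ≤ lam → lam ≤ lamStar →
      ∃! ρ, Hartree.IsSelfConsistent h ν β lam n ρ) := by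
  refine ⟨fun lam _ => Hartree.exists_isSelfConsistent hh ν lam hβ hn hnN, fun lam _ ρ hρ => ?_, ?_⟩
  · have := Hartree.commute_fermiDirac β (Hartree.sampleChemicalPotential h ν β lam n ρ)
      (h + Hartree.hartreePotential ν lam ρ)
    rwa [← hρ.eq_fermiDirac] at this
  · obtain ⟨lamStar, hpos, huniq⟩ :=
      Hartree.exists_forall_isSelfConsistent_unique hh ν hβ hn hnN
    refine ⟨lamStar, hpos, fun lam h0 hlam => ?_⟩
    obtain ⟨ρ, hρ⟩ := Hartree.exists_isSelfConsistent hh ν lam hβ hn hnN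
    exact ⟨ρ, hρ, fun σ hσ => huniq lam h0 hlam σ ρ hσ hρ⟩
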